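/- Let $\mathcal L(\Box,\rhd)$-formulas be given by $A ::= \bot \mid p \mid A\to A \mid \Box A \mid A\rhd A$ and $\mathcal L(\Box,\mathsf I)$-formulas by $A ::= \bot \mid p \mid A\to A \mid \Box A \mid \mathsf I A$, where $p$ ranges over countably many propositional variables; $\top,\neg,\wedge,\vee,\leftrightarrow$ are defined as usual and $\Diamond A := \neg\Box\neg A$. Every $\mathcal L(\Box,\mathsf I)$-formula is read as an $\mathcal L(\Box,\rhd)$-formula by taking $\mathsf I A$ as an abbreviation of $\top\rhd A$. Consider the following axiom schemata in $\mathcal L(\Box,\rhd)$. G1: all tautologies; G2: $\Box(A\to B)\to(\Box A\to\Box B)$; G3: $\Box(\Box A\to A)\to\Box A$; J1: $\Box(A\to B)\to A\rhd B$; J2: $(A\rhd B)\wedge(B\rhd C)\to A\rhd C$; J2$_+$: $(A\rhd(B\vee C))\wedge(B\rhd C)\to A\rhd C$; J3: $(A\rhd C)\wedge(B\rhd C)\to(A\vee B)\rhd C$; J4: $A\rhd B\to(\Diamond A\to\Diamond B)$; J4$_+$: $\Box(A\to B)\to(C\rhd A\to C\rhd B)$; J5: $\Diamond A\rhd A$;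 J6: $\Box A\leftrightarrow(\neg A\rhd\bot)$. The logic $\mathbf{IL}$ has the axioms G1–G3, J1–J5 and the rules Modus Ponens and Necessitation; $\mathbf{CL}$ is $\mathbf{IL}$ without J5. The logic $\mathbf{IL}^-$ has the axioms G1, G2, G3, J3, J6 and the rules Modus Ponens, Necessitation, R1: from $A\to B$ infer $(C\rhd A)\to(C\rhd B)$, and R2: from $A\to B$ infer $(B\rhd C)\to(A\rhd C)$. In $\mathcal L(\Box,\mathsf I)$ consider J1$'$: $\Box A\to\mathsf I A$; J15$'$: $\Box(A\vee\Diamond A)\to\mathsf I A$; J25$'$: $\Box(A\to\Diamond B)\to(\mathsf I A\to\mathsf I B)$; I2: $\Box(A\to B)\to(\mathsf I A\to\mathsf I B)$; I3: $\mathsf I(A\vee\Diamond A)\to\mathsf I A$; I4: $\mathsf I A\wedge\Diamond\top\to\Diamond A$. The logic $\mathbf{il}^-$ has as axioms all tautologies of $\mathcal L(\Box,\mathsf I)$, G2, G3 and $\Box\bot\leftrightarrow\mathsf I\bot$, and the rules Modus Ponens, Necessitation, and: from $A\to B$ infer $\mathsf I A\to\mathsf I B$. For a logic $L$ write $L(\Sigma_1,\dots,\Sigma_k)$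 for the logic with the additional axiom schemata $\Sigma_1,\dots,\Sigma_k$ and the same rules. **Theorem.** Let $(L,\ell)$ be one of the following twenty pairs: - $(\mathbf{IL}^-,\ \mathbf{il}^-)$, $(\mathbf{IL}^-(\mathrm{J5}),\ \mathbf{il}^-)$; - $(\mathbf{IL}^-(\mathrm{J1}),\ \mathbf{il}^-(\mathrm{J1}'))$; - $(\mathbf{IL}^-(\mathrm{J4}_+),\ \mathbf{il}^-(\mathrm{I2}))$, $(\mathbf{IL}^-(\mathrm{J4}_+,\mathrm{J5}),\ \mathbf{il}^-(\mathrm{I2}))$, $(\mathbf{IL}^-(\mathrm{J2}_+),\ \mathbf{il}^-(\mathrm{I2}))$, $(\mathbf{IL}^-(\mathrm{J2},\mathrm{J4}_+),\ \mathbf{il}^-(\mathrm{I2}))$; - $(\mathbf{IL}^-(\mathrm{J1},\mathrm{J5}),\ \mathbf{il}^-(\mathrm{J15}'))$; - $(\mathbf{IL}^-(\mathrm{J1},\mathrm{J4}_+),\ \mathbf{il}^-(\mathrm{J1}',\mathrm{I2}))$, $(\mathbf{CL},\ \mathbf{il}^-(\mathrm{J1}',\mathrm{I2}))$; - $(\mathbf{IL}^-(\mathrm{J1},\mathrm{J4}_+,\mathrm{J5}),\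 \mathbf{il}^-(\mathrm{J15}',\mathrm{I2}))$; - $(\mathbf{IL}^-(\mathrm{J2}_+,\mathrm{J5}),\ \mathbf{il}^-(\mathrm{I2},\mathrm{I3}))$; - $(\mathbf{IL},\ \mathbf{il}^-(\mathrm{J1}',\mathrm{I2},\mathrm{I3}))$; - $(\mathbf{IL}^-(\mathrm{J4}),\ \mathbf{il}^-(\mathrm{I4}))$, $(\mathbf{IL}^-(\mathrm{J4},\mathrm{J5}),\ \mathbf{il}^-(\mathrm{I4}))$, $(\mathbf{IL}^-(\mathrm{J2}),\ \mathbf{il}^-(\mathrm{I4}))$; - $(\mathbf{IL}^-(\mathrm{J1},\mathrm{J4}),\ \mathbf{il}^-(\mathrm{J1}',\mathrm{I4}))$; - $(\mathbf{IL}^-(\mathrm{J1},\mathrm{J4},\mathrm{J5}),\ \mathbf{il}^-(\mathrm{J15}',\mathrm{I4}))$; - $(\mathbf{IL}^-(\mathrm{J2},\mathrm{J5}),\ \mathbf{il}^-(\mathrm{J25}',\mathrm{I4}))$; - $(\mathbf{IL}^-(\mathrm{J2},\mathrm{J4}_+,\mathrm{J5}),\ \mathbf{il}^-(\mathrm{I2},\mathrm{J25}'))$.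 Then for every $\mathcal L(\Box,\mathsf I)$-formula $A$, $L\vdash A$ if and only if $\ell\vdash A$. The same holds when $\mathbf{CL}$ and $\mathbf{IL}$ are presented as $\mathbf{IL}^-(\mathrm{J1},\mathrm{J2}_+)$ and $\mathbf{IL}^-(\mathrm{J1},\mathrm{J2}_+,\mathrm{J5})$. -/

import Mathlib

namespace UnaryIL

/-! ## The binary language `L(□, ▷)` -/

/-- Formulas `A ::= ⊥ | p | A → A | □A | A ▷ A`, over the variables `p₀, p₁, …`. -/
inductive Fml : Type
  | bot : Fml
  | var : ℕ → Fml
  | imp : Fml → Fml → Fml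
  | box : Fml → Fml
  | rhd : Fml → Fml → Fml

namespace Fml

def neg (A : Fml) : Fml := imp A bot
def top : Fml := neg bot
def or (A B : Fml) : Fml := imp (neg A) B
def and (A B : Fml) : Fml := neg (imp A (neg B))
def iff (A B : Fml) : Fml := and (imp A B) (imp B A)
def dia (A : Fml) : Fml := neg (box (neg A))

/-- `A` is a tautology in the language `L(□, ▷)`: it is true under every Boolean valuation of
formulas, where variables, boxed formulas and formulas `A ▷ B` are treated as atoms. -/
def IsTautology (A : Fml) : Prop :=
  ∀ v : Fml → Prop, ¬ v bot → (∀ B C, v (imp B C) ↔ (v B → v C)) → v A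

/-- J1: `□(A → B) → A ▷ B`. -/
def J1 : Set Fml := {F | ∃ A B, F = imp (box (imp A B)) (rhd A B)}

/-- J2: `(A ▷ B) ∧ (B ▷ C) → A ▷ C`. -/
def J2 : Set Fml := {F | ∃ A B C, F = imp (and (rhd A B) (rhd B C)) (rhd A C)}

/-- J2₊: `(A ▷ (B ∨ C)) ∧ (B ▷ C) → A ▷ C`. -/
def J2p : Set Fml := {F | ∃ A B C, F = imp (and (rhd A (or B C)) (rhd B C)) (rhd A C)}

/-- J3: `(A ▷ C) ∧ (B ▷ C) → (A ∨ B) ▷ C`. -/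
def J3 : Set Fml := {F | ∃ A B C, F = imp (and (rhd A C) (rhd B C)) (rhd (or A B) C)}

/-- J4: `A ▷ B → (◇A → ◇B)`. -/
def J4 : Set Fml := {F | ∃ A B, F = imp (rhd A B) (imp (dia A) (dia B))}

/-- J4₊: `□(A → B) → (C ▷ A → C ▷ B)`. -/
def J4p : Set Fml := {F | ∃ A B C, F = imp (box (imp A B)) (imp (rhd C A) (rhd C B))}

/-- J5: `◇A ▷ A`. -/
def J5 : Set Fml := {F | ∃ A, F = rhd (dia A) A}

/-- J6: `□A ↔ (¬A ▷ ⊥)`. -/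
def J6 : Set Fml := {F | ∃ A, F = iff (box A) (rhd (neg A) bot)}

end Fml

open Fml in
/-- `GLProves X A`: `A` is derivable from G1, G2, G3 and the axioms in `X` by Modus Ponens and
Necessitation. -/
inductive GLProves (X : Set Fml) : Fml → Prop
  | ax {A : Fml} : A ∈ X → GLProves X A
  | G1 {A : Fml} : IsTautology A → GLProves X A
  | G2 (A B : Fml) : GLProves X (imp (box (imp A B)) (imp (box A) (box B)))
  | G3 (A : Fml) : GLProves X (imp (box (imp (box A) A)) (box A))
  | mp {A B : Fml} : GLProves X A → GLProves X (imp A B) → GLProves X B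
  | nec {A : Fml} : GLProves X A → GLProves X (box A)

/-- Provability in the interpretability logic `IL`. -/
def IL : Fml → Prop := GLProves (Fml.J1 ∪ Fml.J2 ∪ Fml.J3 ∪ Fml.J4 ∪ Fml.J5)

/-- Provability in the conservativity logic `CL`, i.e. `IL` without J5. -/
def CL : Fml → Prop := GLProves (Fml.J1 ∪ Fml.J2 ∪ Fml.J3 ∪ Fml.J4)

open Fml in
/-- `ILm X A`: `A` is provable in `IL⁻(X)`, the logic `IL⁻` with the additional axioms in `X`. -/
inductive ILm (X : Set Fml) : Fml → Prop
  | ax {A : Fml} : A ∈ X → ILm X A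
  | G1 {A : Fml} : IsTautology A → ILm X A
  | G2 (A B : Fml) : ILm X (imp (box (imp A B)) (imp (box A) (box B)))
  | G3 (A : Fml) : ILm X (imp (box (imp (box A) A)) (box A))
  | J3 {A : Fml} : A ∈ Fml.J3 → ILm X A
  | J6 {A : Fml} : A ∈ Fml.J6 → ILm X A
  | mp {A B : Fml} : ILm X A → ILm X (imp A B) → ILm X B
  | nec {A : Fml} : ILm X A → ILm X (box A)
  | R1 {A B : Fml} (C : Fml) : ILm X (imp A B) → ILm X (imp (rhd C A) (rhd C B))
  | R2 {A B : Fml} (C : Fml) : ILm X (imp A B) → ILm X (imp (rhd B C) (rhd A C))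

/-! ## The unary language `L(□, I)` -/

/-- Formulas `A ::= ⊥ | p | A → A | □A | I A`, over the variables `p₀, p₁, …`. -/
inductive UFml : Type
  | bot : UFml
  | var : ℕ → UFml
  | imp : UFml → UFml → UFml
  | box : UFml → UFml
  | I : UFml → UFml

namespace UFml

/-- Reading an `L(□, I)`-formula as an `L(□, ▷)`-formula, `I A` abbreviating `⊤ ▷ A`. -/
def toFml : UFml → Fml
  | bot => Fml.bot
  | var n => Fml.var n
  | imp A B => Fml.imp A.toFml B.toFml
  | box A => Fml.box A.toFml
  | I A => Fml.rhd Fml.top A.toFml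

def neg (A : UFml) : UFml := imp A bot
def top : UFml := neg bot
def or (A B : UFml) : UFml := imp (neg A) B
def and (A B : UFml) : UFml := neg (imp A (neg B))
def iff (A B : UFml) : UFml := and (imp A B) (imp B A)
def dia (A : UFml) : UFml := neg (box (neg A))

/-- `A` is a tautology in the language `L(□, I)`. -/
def IsTautology (A : UFml) : Prop :=
  ∀ v : UFml → Prop, ¬ v bot → (∀ B C, v (imp B C) ↔ (v B → v C)) → v A

/-- J1′: `□A → I A`. -/
def uJ1 : Set UFml := {F | ∃ A, F = imp (box A) (I A)}

/-- J15′: `□(A ∨ ◇A) → I A`. -/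
def uJ15 : Set UFml := {F | ∃ A, F = imp (box (or A (dia A))) (I A)}

/-- J25′: `□(A → ◇B) → (I A → I B)`. -/
def uJ25 : Set UFml := {F | ∃ A B, F = imp (box (imp A (dia B))) (imp (I A) (I B))}

/-- I2: `□(A → B) → (I A → I B)`. -/
def I2 : Set UFml := {F | ∃ A B, F = imp (box (imp A B)) (imp (I A) (I B))}

/-- I3: `I (A ∨ ◇A) → I A`. -/
def I3 : Set UFml := {F | ∃ A, F = imp (I (or A (dia A))) (I A)}

/-- I4: `I A ∧ ◇⊤ → ◇A`. -/
def I4 : Set UFml := {F | ∃ A, F = imp (and (I A) (dia top)) (dia A)}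

end UFml

open UFml in
/-- `ilm X A`: `A` is provable in `il⁻(X)`, the logic `il⁻` with the additional axioms in `X`.
The constructor `uJ6` is the axiom `□⊥ ↔ I ⊥`, and `uR` the rule `A → B / I A → I B`. -/
inductive ilm (X : Set UFml) : UFml → Prop
  | ax {A : UFml} : A ∈ X → ilm X A
  | G1 {A : UFml} : IsTautology A → ilm X A
  | G2 (A B : UFml) : ilm X (imp (box (imp A B)) (imp (box A) (box B)))
  | G3 (A : UFml) : ilm X (imp (box (imp (box A) A)) (box A))
  | uJ6 : ilm X (iff (box bot) (I bot))
  | mp {A B : UFml} : ilm X A → ilm X (imp A B) → ilm X B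
  | nec {A : UFml} : ilm X A → ilm X (box A)
  | uR {A B : UFml} : ilm X (imp A B) → ilm X (imp (I A) (I B))

open Fml UFml in
/-- The rows `(L, ℓ)`: a sublogic `L` of `IL` and the unary logic `ℓ` that corresponds to it.
There are twenty sublogics; `CL` and `IL` are each listed in two presentations, the original one
and the one as an extension of `IL⁻`. -/
def table : List ((Fml → Prop) × (UFml → Prop)) :=
  [ (ILm ∅, ilm ∅),
    (ILm J5, ilm ∅),
    (ILm J1, ilm uJ1),
    (ILm J4p, ilm I2),
    (ILm (J4p ∪ J5), ilm I2),
    (ILm J2p, ilm I2),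
    (ILm (J1 ∪ J5), ilm uJ15),
    (ILm (J1 ∪ J4p), ilm (uJ1 ∪ I2)),
    (CL, ilm (uJ1 ∪ I2)),
    (ILm (J1 ∪ J2p), ilm (uJ1 ∪ I2)),
    (ILm (J1 ∪ J4p ∪ J5), ilm (uJ15 ∪ I2)),
    (ILm (J2p ∪ J5), ilm (I2 ∪ I3)),
    (IL, ilm (uJ1 ∪ I2 ∪ I3)),
    (ILm (J1 ∪ J2p ∪ J5), ilm (uJ1 ∪ I2 ∪ I3)),
    (ILm J4, ilm I4),
    (ILm (J4 ∪ J5), ilm I4),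
    (ILm J2, ilm I4),
    (ILm (J1 ∪ J4), ilm (uJ1 ∪ I4)),
    (ILm (J1 ∪ J4 ∪ J5), ilm (uJ15 ∪ I4)),
    (ILm (J2 ∪ J5), ilm (uJ25 ∪ I4)),
    (ILm (J2 ∪ J4p), ilm I2),
    (ILm (J2 ∪ J4p ∪ J5), ilm (I2 ∪ uJ25)) ]

end UnaryIL

/-! From right to left the theorem is an induction on derivations: every axiom of `ℓ`, with `I A`
read as `⊤ ▷ A`, is derivable in `L`.

The converse uses a syntactic translation instead of semantics. In `L` there are two evident reasons
for `A ▷ B`: either `⊤ ▷ B` holds, or the axioms J1 and J5 yield `A ▷ B` from a boxed implication.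
So `A ▷ B` is replaced by `□(A → δ B) ∨ I B`, where `δ B` is `⊥` if neither J1 nor J5 is present,
`B` if only J1 is, `◇B` if only J5 is, and `B ∨ ◇B` if both are.

Two facts suffice. The translation sends theorems of `L` to theorems of `ℓ` (`ILm.toUnary`, with one
lemma for each axiom). It also leaves unary formulas unchanged up to provable equivalence
(`UWorld.toUnary_toFml`): `⊤ ▷ A` becomes `□(⊤ → δ A) ∨ I A`, which collapses to `I A` as soon as
`ℓ` proves `□(δ A) → I A`. For `⊥` this follows from `□⊥ ↔ I ⊥`, for `◇A` one also needs Löb's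
axiom, and the other two cases come from J1′, J15′, or J1′ with I3. `ILm_toFml_iff_ilm` combines all
this into a criterion that is checked for each row.

Propositional reasoning inside a logic is done by passing to its worlds, the Boolean valuations that
make all its theorems true. -/

namespace UnaryIL

/-! ## Boolean valuations containing a logic -/

/-- `v` is a Boolean valuation (with respect to `bot` and `imp`) making all of `P` true. -/
structure IsWorld {F : Type} (bot : F) (imp : F → F → F) (P v : F → Prop) : Prop where
  bot : ¬ v bot
  imp : ∀ B C, v (imp B C) ↔ (v B → v C)
  thm : ∀ {B}, P B → v B

/-- A set of formulas containing the tautologies and closed under modus ponens contains every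
formula that is true in all of its worlds. -/
theorem mem_of_forall_isWorld {F : Type} {bot : F} {imp : F → F → F} {P : F → Prop}
    (taut : ∀ A, (∀ v : F → Prop, ¬ v bot → (∀ B C, v (imp B C) ↔ (v B → v C)) → v A) → P A)
    (mp : ∀ A B, P A → P (imp A B) → P B) {A : F}
    (h : ∀ v, IsWorld bot imp P v → v A) : P A := by
  by_contra hA
  let S : Set (Set F) :=
    {T | (∀ B, P B → B ∈ T) ∧ (∀ B C, B ∈ T → imp B C ∈ T → C ∈ T) ∧ A ∉ T}
  obtain ⟨T, -, hT⟩ := zorn_subset_nonempty S (by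
    intro c hc hch hne
    refine ⟨⋃₀ c, ⟨?_, ?_, ?_⟩, fun s hs => Set.subset_sUnion_of_mem hs⟩
    · intro B hB
      obtain ⟨s, hs⟩ := hne
      exact ⟨s, hs, (hc hs).1 B hB⟩
    · rintro B C ⟨s, hs, hB⟩ ⟨t, ht, hBC⟩
      rcases hch.total hs ht with hst | hts
      · exact ⟨t, ht, (hc ht).2.1 B C (hst hB) hBC⟩
      · exact ⟨s, hs, (hc hs).2.1 B C hB (hts hBC)⟩
    · rintro ⟨s, hs, hAs⟩
      exact (hc hs).2.2 hAs) {B | P B} ⟨fun _ h => h, mp, hA⟩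
  obtain ⟨hP, hmp, hAT⟩ := hT.prop
  have htaut : ∀ B, (∀ v : F → Prop, ¬ v bot → (∀ B C, v (imp B C) ↔ (v B → v C)) → v B) →
      B ∈ T := fun B hB => hP B (taut B hB)
  -- The set of all `C` with `B → C` in `T` is closed under modus ponens and contains `T` and `B`.
  -- If it missed `A`, it would contradict the maximality of `T`.
  have hdich : ∀ B, B ∉ T → imp B A ∈ T := by
    intro B hB
    by_contra hBA
    have hS : {C | imp B C ∈ T} ∈ S := by
      refine ⟨fun C hC => ?_, fun C D hC hCD => ?_, hBA⟩
      · refine hmp C _ (hP C hC) (htaut _ fun v _ hv => ?_)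
        simp only [hv]; tauto
      · refine hmp _ _ hCD (hmp _ _ hC (htaut _ fun v _ hv => ?_))
        simp only [hv]; tauto
    have hle : T ⊆ {C | imp B C ∈ T} := fun C hC =>
      hmp C _ hC (htaut _ fun v _ hv => by simp only [hv]; tauto)
    exact hB (hT.le_of_ge hS hle (htaut _ fun v _ hv => by simp only [hv]; tauto))
  refine hAT (h (· ∈ T) ⟨fun hb => hAT ?_, fun B C => ⟨fun h hB => hmp B C hB h, fun h => ?_⟩,
    fun {B} hB => hP B hB⟩)
  · exact hmp _ _ hb (htaut _ fun v hb hv => by simp only [hv]; tauto)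
  -- When `B ∉ T` and `B → C ∉ T`, both `B → A` and `(B → C) → A` lie in `T`, and together they
  -- imply `A`.
  · by_cases hB : B ∈ T
    · exact hmp _ _ (h hB) (htaut _ fun v _ hv => by simp only [hv]; tauto)
    · by_contra hBC
      exact hAT (hmp _ _ (hdich _ hBC) (hmp _ _ (hdich _ hB)
        (htaut _ fun v _ hv => by simp only [hv]; tauto)))

/-! ## Reasoning in the unary logics -/

/-- Worlds of the unary logic `ilm Y`. -/
abbrev UWorld (Y : Set UFml) (v : UFml → Prop) : Prop := IsWorld UFml.bot UFml.imp (ilm Y) v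

theorem ilm.of_forall_world {Y : Set UFml} {A : UFml} (h : ∀ v, UWorld Y v → v A) : ilm Y A :=
  mem_of_forall_isWorld (fun _ h => .G1 h) (fun _ _ => .mp) h

namespace UWorld

open UFml

variable {Y : Set UFml} {v : UFml → Prop} {A B C : UFml}

theorem neg (w : UWorld Y v) : v (neg A) ↔ ¬ v A := by
  simp [UFml.neg, w.imp, w.bot]

theorem top (w : UWorld Y v) : v top := w.neg.2 w.bot

theorem or (w : UWorld Y v) : v (or A B) ↔ v A ∨ v B := by
  rw [UFml.or, w.imp, w.neg]; tauto

theorem and (w : UWorld Y v) : v (and A B) ↔ v A ∧ v B := by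
  rw [UFml.and, w.neg, w.imp, w.neg]; tauto

theorem iff (w : UWorld Y v) : v (iff A B) ↔ (v A ↔ v B) := by
  rw [UFml.iff, w.and, w.imp, w.imp]; tauto

theorem dia (w : UWorld Y v) : v (dia A) ↔ ¬ v (box (UFml.neg A)) := w.neg

theorem box_of (w : UWorld Y v) (h : ∀ u, UWorld Y u → u A) : v (box A) :=
  w.thm (.nec (.of_forall_world h))

theorem box_mp (w : UWorld Y v) (h : v (box (imp A B))) (hA : v (box A)) : v (box B) :=
  (w.imp _ _).1 ((w.imp _ _).1 (w.thm (.G2 A B)) h) hA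

theorem box_mono (w : UWorld Y v) (h : ∀ u, UWorld Y u → u A → u B) (hA : v (box A)) :
    v (box B) :=
  w.box_mp (w.box_of fun u wu => (wu.imp _ _).2 (h u wu)) hA

theorem box_mono₂ (w : UWorld Y v) (h : ∀ u, UWorld Y u → u A → u B → u C)
    (hA : v (box A)) (hB : v (box B)) : v (box C) :=
  w.box_mp (w.box_mono (fun u wu hA => (wu.imp _ _).2 (h u wu hA)) hA) hB

theorem loeb (w : UWorld Y v) (h : v (box (imp (box A) A))) : v (box A) :=
  (w.imp _ _).1 (w.thm (.G3 A)) h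

/-- The usual derivation of axiom 4 in GL: Löb's axiom is applied to `A ∧ □A`. -/
theorem box_box (w : UWorld Y v) (h : v (box A)) : v (box (box A)) := by
  have : v (box (UFml.and A (box A))) := by
    refine w.loeb (w.box_mono (fun u wu hA => (wu.imp _ _).2 fun hb => wu.and.2 ⟨hA, ?_⟩) h)
    exact wu.box_mono (fun t wt ht => (wt.and.1 ht).1) hb
  exact w.box_mono (fun u wu hu => (wu.and.1 hu).2) this

/-- `◇A` refutes `□⊥`, so `□◇A` gives `□(□⊥ → ⊥)`, and Löb's axiom applies. -/
theorem box_bot_of_box_dia (w : UWorld Y v) (h : v (box (UFml.dia A))) : v (box bot) := by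
  refine w.loeb (w.box_mono (fun u wu hu => (wu.imp _ _).2 fun hb => ?_) h)
  exact absurd (wu.box_mono (fun t wt ht => absurd ht wt.bot) hb) (wu.dia.1 hu)

/-- By axiom 4, `□¬C` gives `□(¬C ∧ □¬C)`, which excludes `C ∨ ◇C` under the box. -/
theorem box_neg_of_box_imp (w : UWorld Y v) (h : v (box (imp B (UFml.or C (UFml.dia C)))))
    (hC : v (box (UFml.neg C))) : v (box (UFml.neg B)) := by
  have h4 := w.box_box hC
  have := w.box_mono₂ (C := UFml.neg (UFml.or C (UFml.dia C)))
    (fun u wu h₁ h₂ => by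
      simp only [wu.neg, wu.or, wu.dia] at *; tauto) hC h4
  exact w.box_mono₂ (fun u wu h₁ h₂ => by simp only [wu.neg, wu.imp] at *; tauto) h this

theorem I_mono (w : UWorld Y v) (h : ∀ u, UWorld Y u → u A → u B) (hA : v (I A)) : v (I B) :=
  (w.imp _ _).1 (w.thm (.uR (.of_forall_world fun u wu => (wu.imp _ _).2 (h u wu)))) hA

theorem I_bot (w : UWorld Y v) : v (I bot) ↔ v (box bot) :=
  (w.iff.1 (w.thm .uJ6)).symm

theorem I_of_box_bot (w : UWorld Y v) (h : v (box bot)) : v (I A) :=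
  w.I_mono (fun _ wu hu => absurd hu wu.bot) (w.I_bot.2 h)

theorem uJ1 (w : UWorld Y v) (hY : uJ1 ⊆ Y) (h : v (box A)) : v (I A) :=
  (w.imp _ _).1 (w.thm (.ax (hY ⟨A, rfl⟩))) h

theorem uJ15 (w : UWorld Y v) (hY : uJ15 ⊆ Y) (h : v (box (UFml.or A (UFml.dia A)))) :
    v (I A) :=
  (w.imp _ _).1 (w.thm (.ax (hY ⟨A, rfl⟩))) h

theorem uJ25 (w : UWorld Y v) (hY : uJ25 ⊆ Y) (h : v (box (imp A (UFml.dia B))))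
    (hA : v (I A)) : v (I B) :=
  (w.imp _ _).1 ((w.imp _ _).1 (w.thm (.ax (hY ⟨A, B, rfl⟩))) h) hA

theorem I2 (w : UWorld Y v) (hY : I2 ⊆ Y) (h : v (box (imp A B))) (hA : v (I A)) : v (I B) :=
  (w.imp _ _).1 ((w.imp _ _).1 (w.thm (.ax (hY ⟨A, B, rfl⟩))) h) hA

theorem I3 (w : UWorld Y v) (hY : I3 ⊆ Y) (h : v (I (UFml.or A (UFml.dia A)))) : v (I A) :=
  (w.imp _ _).1 (w.thm (.ax (hY ⟨A, rfl⟩))) h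

theorem box_bot_of_I2 (w : UWorld Y v) (hY : UFml.I2 ⊆ Y) (hA : v (I A))
    (h : v (box (UFml.neg A))) : v (box bot) :=
  w.I_bot.1 (w.I2 hY h hA)

theorem box_bot_of_I4 (w : UWorld Y v) (hY : I4 ⊆ Y) (hA : v (I A))
    (h : v (box (UFml.neg A))) : v (box bot) := by
  have := w.thm (.ax (hY ⟨A, rfl⟩))
  rw [w.imp, w.and, w.dia, w.dia] at this
  by_contra hb
  refine this ⟨hA, fun ht => hb (w.box_mono (fun u wu hu => ?_) ht)⟩ h
  exact absurd wu.top (wu.neg.1 hu)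

/-- I2 weakens `I (B ∨ C)` to `I (C ∨ ◇C)`, and I3 removes the `◇C`. This is the unary content of
J2₊ together with J5. -/
theorem I_of_I2_I3 (w : UWorld Y v) (h2 : UFml.I2 ⊆ Y) (h3 : UFml.I3 ⊆ Y)
    (h : v (box (imp B (UFml.or C (UFml.dia C))))) (hB : v (I (UFml.or B C))) : v (I C) := by
  refine w.I3 h3 (w.I2 h2 (w.box_mono (fun u wu hu => ?_) h) hB)
  simp only [wu.imp, wu.or] at *; tauto

end UWorld

/-! ## Translating the binary into the unary language -/

/-- The translation that replaces `A ▷ B` by `□(A → δ B) ∨ I B`. -/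
def Fml.toUnary (δ : UFml → UFml) : Fml → UFml
  | .bot => .bot
  | .var n => .var n
  | .imp A B => .imp (A.toUnary δ) (B.toUnary δ)
  | .box A => .box (A.toUnary δ)
  | .rhd A B => .or (.box (.imp (A.toUnary δ) (δ (B.toUnary δ)))) (.I (B.toUnary δ))

/-- The properties of an operation `δ` that make the translation `Fml.toUnary δ` well behaved. -/
structure IsWitness (δ : UFml → UFml) : Prop where
  -- `bot` serves J6, `mono` the rule R1 and J2, `box_mono` serves J4₊, `join` the transitivity
  -- axioms J2 and J2₊, and `le` serves J4.
  bot : ∀ {Y v}, UWorld Y v → ¬ v (δ .bot)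
  mono : ∀ {Y A B}, (∀ v, UWorld Y v → v A → v B) → ∀ v, UWorld Y v → v (δ A) → v (δ B)
  box_mono : ∀ {Y v A B}, UWorld Y v → v (.box (.imp A B)) → v (.box (.imp (δ A) (δ B)))
  join : ∀ {Y v B C}, UWorld Y v → v (.box (.imp B (δ C))) →
    v (.box (.imp (δ (.or B C)) (δ C)))
  le : ∀ {Y v A}, UWorld Y v → v (δ A) → v (.or A (.dia A))

/-! ### The four choices of `δ` -/

theorem isWitness_bot : IsWitness fun _ => .bot where
  bot w := w.bot
  mono _ _ _ := id
  box_mono w _ := w.box_of fun _ wu => (wu.imp _ _).2 id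
  join w _ := w.box_of fun _ wu => (wu.imp _ _).2 id
  le w h := absurd h w.bot

theorem isWitness_id : IsWitness fun A => A where
  bot w := w.bot
  mono h := h
  box_mono _ h := h
  join w h := w.box_mono (fun u wu hu => by simp only [wu.imp, wu.or] at *; tauto) h
  le w h := w.or.2 (.inl h)

theorem UWorld.dia_mono {Y v A B} (w : UWorld Y v) (h : v (.box (.imp A B)))
    (hA : v (.dia A)) : v (.dia B) := by
  rw [w.dia] at *
  exact fun hB => hA (w.box_mono₂ (fun u wu h₁ h₂ => by
    simp only [wu.imp, wu.neg] at *; tauto) h hB)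

theorem UWorld.box_dia_mono {Y v A B} (w : UWorld Y v) (h : v (.box (.imp A B))) :
    v (.box (.imp (.dia A) (.dia B))) :=
  w.box_mono (fun _ wu hu => (wu.imp _ _).2 (wu.dia_mono hu)) (w.box_box h)

theorem UWorld.dia_join {Y v B C} (w : UWorld Y v)
    (h : v (.box (.imp B (.or C (.dia C))))) : v (.imp (.dia (.or B C)) (.dia C)) := by
  rw [w.imp, w.dia, w.dia]
  exact fun hBC hC => hBC (w.box_mono₂ (fun u wu h₁ h₂ => by
    simp only [wu.or, wu.neg] at *; tauto) hC (w.box_neg_of_box_imp h hC))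

theorem isWitness_dia : IsWitness UFml.dia where
  bot w h := w.dia.1 h (w.box_of fun _ wu => wu.neg.2 wu.bot)
  mono h v w := w.dia_mono (w.box_of fun u wu => (wu.imp _ _).2 (h u wu))
  box_mono w h := w.box_dia_mono h
  join w h := by
    refine w.box_mono (fun u wu hu => wu.dia_join (wu.box_mono (fun t wt ht => ?_) hu))
      (w.box_box h)
    simp only [wt.or, wt.imp] at *
    exact fun h => .inr (ht h)
  le w h := w.or.2 (.inr h)

theorem isWitness_or_dia : IsWitness fun A => .or A (.dia A) where
  bot w h := (w.or.1 h).elim w.bot (isWitness_dia.bot w)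
  mono h v w hA := w.or.2 ((w.or.1 hA).imp (h v w) (isWitness_dia.mono h v w))
  box_mono w h := w.box_mono₂ (fun u wu h₁ h₂ => by
    simp only [wu.or, wu.imp] at *; tauto) h (w.box_dia_mono h)
  join w h := w.box_mono₂ (fun u wu h₁ h₂ => by
    have := wu.dia_join h₂
    simp only [wu.or, wu.imp] at *; tauto) h (w.box_box h)
  le _ h := h

section Translation

variable {δ : UFml → UFml} {X : Set Fml} {Y : Set UFml}

theorem toUnary_isTautology {A : Fml} (h : A.IsTautology) : (A.toUnary δ).IsTautology :=
  fun v hb hv => h (fun B => v (B.toUnary δ)) hb fun _ _ => hv _ _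

theorem UWorld.toUnary_rhd {v} (w : UWorld Y v) {A B : Fml} :
    v ((A.rhd B).toUnary δ) ↔
      v (.box (.imp (A.toUnary δ) (δ (B.toUnary δ)))) ∨ v (.I (B.toUnary δ)) := w.or

theorem UWorld.toUnary_and {v} (w : UWorld Y v) {A B : Fml} :
    v ((A.and B).toUnary δ) ↔ v (A.toUnary δ) ∧ v (B.toUnary δ) := w.and

theorem UWorld.toUnary_iff {v} (w : UWorld Y v) {A B : Fml} :
    v ((A.iff B).toUnary δ) ↔ (v (A.toUnary δ) ↔ v (B.toUnary δ)) := w.iff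

theorem UWorld.toUnary_or {v} (w : UWorld Y v) {A B : Fml} :
    v ((A.or B).toUnary δ) ↔ v (A.toUnary δ) ∨ v (B.toUnary δ) := w.or

theorem UWorld.toUnary_neg {v} (w : UWorld Y v) {A : Fml} :
    v (A.neg.toUnary δ) ↔ ¬ v (A.toUnary δ) := w.neg

theorem UWorld.toUnary_imp {v} (w : UWorld Y v) {A B : Fml} :
    v ((A.imp B).toUnary δ) ↔ (v (A.toUnary δ) → v (B.toUnary δ)) := w.imp _ _

/-! ### The binary axioms and rules under the translation -/

theorem toUnary_J1 (h : ∀ v, UWorld Y v → ∀ A, v A → v (δ A)) :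
    ∀ A ∈ Fml.J1, ilm Y (A.toUnary δ) := by
  rintro _ ⟨A, B, rfl⟩
  refine .of_forall_world fun v w => w.toUnary_imp.2 fun hAB => w.toUnary_rhd.2 (.inl ?_)
  refine w.box_mono (fun u wu hu => ?_) hAB
  exact (wu.imp _ _).2 fun hA => h u wu _ (wu.toUnary_imp.1 hu hA)

/-- If both premises hold through their boxed disjuncts, then under the box `A` implies `δ B`, hence
`δ (B ∨ C)`, hence `δ C`. The only other nontrivial case is `I B` with `□(B → δ C)`, where `□⊥` is
an admissible outcome because it makes `□(A → δ C)` true. -/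
theorem toUnary_J2 (hδ : IsWitness δ)
    (h : ∀ v, UWorld Y v → ∀ B C, v (.box (.imp B (δ C))) → v (.I B) →
      v (.I C) ∨ v (.box .bot)) :
    ∀ A ∈ Fml.J2, ilm Y (A.toUnary δ) := by
  rintro _ ⟨A, B, C, rfl⟩
  refine .of_forall_world fun v w => w.toUnary_imp.2 fun hABC => ?_
  simp only [w.toUnary_and, w.toUnary_rhd] at *
  rcases hABC with ⟨hAB, hBC | hC⟩
  · rcases hAB with hAB | hB
    · refine .inl (w.box_mono₂ (fun u wu h₁ h₂ => ?_) hAB (hδ.join w hBC))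
      rw [wu.imp] at *
      exact fun hA => h₂ (hδ.mono (fun _ wt ht => wt.or.2 (.inl ht)) u wu (h₁ hA))
    · exact (h v w _ _ hBC hB).elim .inr fun hb =>
        .inl (w.box_mono (fun u wu hu => absurd hu wu.bot) hb)
  · exact .inr hC

theorem toUnary_J2p (hδ : IsWitness δ)
    (h : ∀ v, UWorld Y v → ∀ B C, v (.box (.imp B (δ C))) → v (.I (.or B C)) → v (.I C)) :
    ∀ A ∈ Fml.J2p, ilm Y (A.toUnary δ) := by
  rintro _ ⟨A, B, C, rfl⟩
  refine .of_forall_world fun v w => w.toUnary_imp.2 fun hABC => ?_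
  simp only [w.toUnary_and, w.toUnary_rhd] at *
  rcases hABC with ⟨hAB, hBC | hC⟩
  · rcases hAB with hAB | hB
    · refine .inl (w.box_mono₂ (fun u wu h₁ h₂ => ?_) hAB (hδ.join w hBC))
      rw [wu.imp] at *
      exact fun hA => h₂ (h₁ hA)
    · exact .inr (h v w _ _ hBC hB)
  · exact .inr hC

/-- Nothing is required of `δ`: the disjunct `I C` does not depend on the left argument, and the
boxed disjuncts combine. -/
theorem toUnary_J3 : ∀ A ∈ Fml.J3, ilm Y (A.toUnary δ) := by
  rintro _ ⟨A, B, C, rfl⟩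
  refine .of_forall_world fun v w => w.toUnary_imp.2 fun hABC => ?_
  simp only [w.toUnary_and, w.toUnary_rhd] at *
  rcases hABC with ⟨hA | hC, hB | hC⟩
  · refine .inl (w.box_mono₂ (fun u wu h₁ h₂ => ?_) hA hB)
    simp only [wu.imp, wu.toUnary_or] at *
    tauto
  all_goals exact .inr hC

theorem toUnary_J4 (hδ : IsWitness δ)
    (h : ∀ v, UWorld Y v → ∀ A, v (.I A) → v (.box (.neg A)) → v (.box .bot)) :
    ∀ A ∈ Fml.J4, ilm Y (A.toUnary δ) := by
  rintro _ ⟨A, B, rfl⟩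
  refine .of_forall_world fun v w => w.toUnary_imp.2 fun hAB => w.toUnary_imp.2 fun hA => ?_
  rw [Fml.dia, w.toUnary_neg] at *
  refine fun hB => hA ?_
  rcases w.toUnary_rhd.1 hAB with hAB | hI
  · refine w.box_neg_of_box_imp (w.box_mono (fun u wu hu => ?_) hAB) hB
    rw [wu.imp] at *
    exact fun hA => hδ.le wu (hu hA)
  · exact w.box_mono (fun u wu hu => absurd hu wu.bot) (h v w _ hI hB)

theorem toUnary_J4p (hδ : IsWitness δ) (hY : UFml.I2 ⊆ Y) :
    ∀ A ∈ Fml.J4p, ilm Y (A.toUnary δ) := by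
  rintro _ ⟨A, B, C, rfl⟩
  refine .of_forall_world fun v w => w.toUnary_imp.2 fun hAB => w.toUnary_imp.2 fun hCA => ?_
  rw [w.toUnary_rhd] at *
  refine hCA.imp (fun hCA => ?_) (w.I2 hY hAB)
  exact w.box_mono₂ (fun u wu h₁ h₂ => by rw [wu.imp] at *; tauto) hCA (hδ.box_mono w hAB)

theorem toUnary_J5 (h : ∀ v, UWorld Y v → ∀ A, v (.dia A) → v (δ A)) :
    ∀ A ∈ Fml.J5, ilm Y (A.toUnary δ) := by
  rintro _ ⟨A, rfl⟩
  refine .of_forall_world fun v w => w.toUnary_rhd.2 (.inl (w.box_of fun u wu => ?_))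
  exact (wu.imp _ _).2 (h u wu _)

/-- As `δ ⊥` is refutable, `□(¬A → δ ⊥)` amounts to `□A`; the other disjunct `I ⊥` is `□⊥`, which
implies `□A`. -/
theorem toUnary_J6 (hδ : IsWitness δ) : ∀ A ∈ Fml.J6, ilm Y (A.toUnary δ) := by
  rintro _ ⟨A, rfl⟩
  refine .of_forall_world fun v w => ?_
  rw [w.toUnary_iff, w.toUnary_rhd]
  constructor
  · refine fun h => .inl (w.box_mono (fun u wu hu => ?_) h)
    exact (wu.imp _ _).2 fun hn => absurd hu (wu.toUnary_neg.1 hn)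
  · rintro (h | h)
    · refine w.box_mono (fun u wu hu => ?_) h
      by_contra hA
      exact hδ.bot wu ((wu.imp _ _).1 hu (wu.toUnary_neg.2 hA))
    · exact w.box_mono (fun u wu hu => absurd hu wu.bot) (w.I_bot.1 h)

/-- Soundness of the translation. -/
theorem ILm.toUnary (hδ : IsWitness δ) (hX : ∀ A ∈ X, ilm Y (A.toUnary δ)) {A : Fml}
    (h : ILm X A) : ilm Y (A.toUnary δ) := by
  induction h with
  | ax h => exact hX _ h
  | G1 h => exact .G1 (toUnary_isTautology h)
  | G2 A B => exact .G2 _ _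
  | G3 A => exact .G3 _
  | J3 h => exact toUnary_J3 _ h
  | J6 h => exact toUnary_J6 hδ _ h
  | mp _ _ ih₁ ih₂ => exact .mp ih₁ ih₂
  | nec _ ih => exact .nec ih
  | R1 C _ ih =>
    have ih' : ∀ u, UWorld Y u → _ := fun u wu => wu.toUnary_imp.1 (wu.thm ih)
    refine .of_forall_world fun v w => w.toUnary_imp.2 fun hC => ?_
    rw [w.toUnary_rhd] at *
    refine hC.imp (w.box_mono fun u wu hu => ?_) (w.I_mono ih')
    rw [wu.imp] at *
    exact fun h => hδ.mono ih' u wu (hu h)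
  | R2 C _ ih =>
    refine .of_forall_world fun v w => w.toUnary_imp.2 fun hC => ?_
    rw [w.toUnary_rhd] at *
    refine hC.imp_left (w.box_mono fun u wu hu => ?_)
    rw [wu.imp] at *
    exact fun h => hu (wu.toUnary_imp.1 (wu.thm ih) h)

/-- The translation of a unary formula, read as a binary one, is equivalent to the formula. -/
theorem UWorld.toUnary_toFml (hI : ∀ v, UWorld Y v → ∀ A, v (.box (δ A)) → v (.I A))
    (A : UFml) : ∀ v, UWorld Y v → (v (A.toFml.toUnary δ) ↔ v A) := by
  induction A with
  | bot => exact fun _ _ => Iff.rfl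
  | var n => exact fun _ _ => Iff.rfl
  | imp A B ihA ihB =>
    intro v w
    rw [UFml.toFml, w.toUnary_imp, w.imp, ihA v w, ihB v w]
  | box A ih =>
    exact fun v w => ⟨w.box_mono fun u wu => (ih u wu).1, w.box_mono fun u wu => (ih u wu).2⟩
  | I A ih =>
    intro v w
    rw [UFml.toFml, w.toUnary_rhd]
    constructor
    · rintro (h | h)
      -- The boxed disjunct is `□(⊤ → δ A)`, that is `□(δ A)`, so `hI` absorbs it into `I A`.
      · refine w.I_mono (fun u wu => (ih u wu).1) (hI v w _ (w.box_mono (fun u wu hu => ?_) h))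
        exact (wu.imp _ _).1 hu wu.top
      · exact w.I_mono (fun u wu => (ih u wu).1) h
    · exact fun h => .inr (w.I_mono (fun u wu => (ih u wu).2) h)

theorem ilm_of_ILm_toFml (hδ : IsWitness δ)
    (hI : ∀ v, UWorld Y v → ∀ A, v (.box (δ A)) → v (.I A))
    (hX : ∀ A ∈ X, ilm Y (A.toUnary δ)) {A : UFml} (h : ILm X A.toFml) : ilm Y A :=
  .of_forall_world fun v w => (UWorld.toUnary_toFml hI A v w).1 (w.thm (h.toUnary hδ hX))

end Translation

/-! ## Reasoning in the binary logics -/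

/-- Worlds of a binary logic `P`. -/
abbrev BWorld (P v : Fml → Prop) : Prop := IsWorld Fml.bot Fml.imp P v

namespace BWorld

variable {P v : Fml → Prop} {A B C : Fml}

theorem neg (w : BWorld P v) : v A.neg ↔ ¬ v A := by
  simp [Fml.neg, w.imp, w.bot]

theorem or (w : BWorld P v) : v (A.or B) ↔ v A ∨ v B := by
  rw [Fml.or, w.imp, w.neg]; tauto

theorem and (w : BWorld P v) : v (A.and B) ↔ v A ∧ v B := by
  rw [Fml.and, w.neg, w.imp, w.neg]; tauto

theorem iff (w : BWorld P v) : v (A.iff B) ↔ (v A ↔ v B) := by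
  rw [Fml.iff, w.and, w.imp, w.imp]; tauto

theorem dia (w : BWorld P v) : v A.dia ↔ ¬ v (.box A.neg) := w.neg

end BWorld

theorem ILm.of_forall_world {X : Set Fml} {A : Fml} (h : ∀ v, BWorld (ILm X) v → v A) :
    ILm X A :=
  mem_of_forall_isWorld (fun _ h => .G1 h) (fun _ _ => .mp) h

theorem GLProves.of_forall_world {X : Set Fml} {A : Fml}
    (h : ∀ v, BWorld (GLProves X) v → v A) : GLProves X A :=
  mem_of_forall_isWorld (fun _ h => .G1 h) (fun _ _ => .mp) h

namespace ILm

open Fml (J1 J2 J2p J4 J4p J5)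

variable {X : Set Fml} {v : Fml → Prop} {A B C : Fml}

theorem box_mono (w : BWorld (ILm X) v) (h : ∀ u, BWorld (ILm X) u → u A → u B)
    (hA : v (.box A)) : v (.box B) :=
  (w.imp _ _).1 ((w.imp _ _).1 (w.thm (.G2 A B))
    (w.thm (.nec (.of_forall_world fun u wu => (wu.imp _ _).2 (h u wu))))) hA

theorem rhd_mono_right (w : BWorld (ILm X) v) (h : ∀ u, BWorld (ILm X) u → u A → u B)
    (hA : v (.rhd C A)) : v (.rhd C B) :=
  (w.imp _ _).1 (w.thm (.R1 C (.of_forall_world fun u wu => (wu.imp _ _).2 (h u wu)))) hA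

theorem rhd_mono_left (w : BWorld (ILm X) v) (h : ∀ u, BWorld (ILm X) u → u A → u B)
    (hB : v (.rhd B C)) : v (.rhd A C) :=
  (w.imp _ _).1 (w.thm (.R2 C (.of_forall_world fun u wu => (wu.imp _ _).2 (h u wu)))) hB

theorem rhd_or (w : BWorld (ILm X) v) (hA : v (.rhd A C)) (hB : v (.rhd B C)) :
    v (.rhd (A.or B) C) :=
  (w.imp _ _).1 (w.thm (.J3 ⟨A, B, C, rfl⟩)) (w.and.2 ⟨hA, hB⟩)

theorem rhd_bot_iff (w : BWorld (ILm X) v) : v (.rhd A.neg .bot) ↔ v (.box A) :=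
  (w.iff.1 (w.thm (.J6 ⟨A, rfl⟩))).symm

theorem rhd_of_box_neg (w : BWorld (ILm X) v) (h : v (.box A.neg)) : v (.rhd A B) :=
  rhd_mono_left w (fun u wu hA => by simpa only [wu.neg, not_not] using hA)
    (rhd_mono_right w (fun u wu hu => absurd hu wu.bot) ((rhd_bot_iff w).2 h))

/-- A boxed form of R2, available in all extensions of `IL⁻`: `A` implies `(A ∧ ¬B) ∨ B`, the first
part is necessarily false and so `▷`-related to everything by J6, and J3 joins the two. -/
theorem rhd_strengthen (w : BWorld (ILm X) v) (h : v (.box (.imp A B))) (hB : v (.rhd B C)) :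
    v (.rhd A C) := by
  have h₁ : v (.rhd (A.and B.neg) C) := rhd_of_box_neg w (box_mono w (fun u wu hu => by
    simp only [wu.neg, wu.and, wu.imp] at *; tauto) h)
  exact rhd_mono_left w (fun u wu hA => by
    simp only [wu.neg, wu.and, wu.or] at *; tauto) (rhd_or w h₁ hB)

theorem rhd_J1 (w : BWorld (ILm X) v) (hX : J1 ⊆ X) (h : v (.box (.imp A B))) :
    v (.rhd A B) :=
  (w.imp _ _).1 (w.thm (.ax (hX ⟨A, B, rfl⟩))) h

theorem rhd_J2 (w : BWorld (ILm X) v) (hX : J2 ⊆ X) (h₁ : v (.rhd A B)) (h₂ : v (.rhd B C)) :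
    v (.rhd A C) :=
  (w.imp _ _).1 (w.thm (.ax (hX ⟨A, B, C, rfl⟩))) (w.and.2 ⟨h₁, h₂⟩)

theorem rhd_J2p (w : BWorld (ILm X) v) (hX : J2p ⊆ X) (h₁ : v (.rhd A (B.or C)))
    (h₂ : v (.rhd B C)) : v (.rhd A C) :=
  (w.imp _ _).1 (w.thm (.ax (hX ⟨A, B, C, rfl⟩))) (w.and.2 ⟨h₁, h₂⟩)

theorem rhd_J5 (w : BWorld (ILm X) v) (hX : J5 ⊆ X) : v (.rhd A.dia A) :=
  w.thm (.ax (hX ⟨A, rfl⟩))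

theorem J2_of_J2p (hX : J2p ⊆ X) : ∀ A ∈ J2, ILm X A := by
  rintro _ ⟨A, B, C, rfl⟩
  refine .of_forall_world fun v w => (w.imp _ _).2 fun h => ?_
  obtain ⟨h₁, h₂⟩ := w.and.1 h
  exact rhd_J2p w hX (rhd_mono_right w (fun u wu hu => wu.or.2 (.inl hu)) h₁) h₂

/-- By J6, `□¬B` gives `B ▷ ⊥`; transitivity gives `A ▷ ⊥`, which is `□¬A` by J6 again. -/
theorem J4_of_J2 (hX : ∀ A ∈ J2, ILm X A) : ∀ A ∈ J4, ILm X A := by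
  rintro _ ⟨A, B, rfl⟩
  refine .of_forall_world fun v w => ?_
  rw [w.imp, w.imp, w.dia, w.dia]
  refine fun hAB hA hB => hA ((rhd_bot_iff w).1 (rhd_mono_left w (B := A) (fun u wu hu => ?_) ?_))
  · simpa only [wu.neg, not_not] using hu
  · exact (w.imp _ _).1 (w.thm (hX _ ⟨A, B, .bot, rfl⟩))
      (w.and.2 ⟨hAB, rhd_of_box_neg w hB⟩)

/-! ### The unary axioms in the binary logics -/

theorem toFml_uJ1 (hX : J1 ⊆ X) : ∀ A ∈ UFml.uJ1, ILm X A.toFml := by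
  rintro _ ⟨A, rfl⟩
  refine .of_forall_world fun v w => (w.imp _ _).2 fun h => rhd_J1 w hX ?_
  exact box_mono w (fun u wu hu => (wu.imp _ _).2 fun _ => hu) h

theorem toFml_uJ15 (h1 : J1 ⊆ X) (h5 : J5 ⊆ X) : ∀ A ∈ UFml.uJ15, ILm X A.toFml := by
  rintro _ ⟨A, rfl⟩
  refine .of_forall_world fun v w => (w.imp _ _).2 fun h => ?_
  have hA : v (.rhd A.toFml A.toFml) :=
    rhd_J1 w h1 (w.thm (.nec (.of_forall_world fun u wu => (wu.imp _ _).2 id)))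
  exact rhd_strengthen w (box_mono w (fun u wu hu => (wu.imp _ _).2 fun _ => hu) h)
    (rhd_or w hA (rhd_J5 w h5))

theorem toFml_uJ25 (h2 : J2 ⊆ X) (h5 : J5 ⊆ X) : ∀ A ∈ UFml.uJ25, ILm X A.toFml := by
  rintro _ ⟨A, B, rfl⟩
  refine .of_forall_world fun v w => (w.imp _ _).2 fun h => (w.imp _ _).2 fun hA => ?_
  exact rhd_J2 w h2 hA (rhd_strengthen w h (rhd_J5 w h5))

theorem toFml_I2_of_J4p (hX : J4p ⊆ X) : ∀ A ∈ UFml.I2, ILm X A.toFml := by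
  rintro _ ⟨A, B, rfl⟩
  exact .ax (hX ⟨_, _, _, rfl⟩)

/-- Weaken `⊤ ▷ A` to `⊤ ▷ ((A ∧ ¬B) ∨ B)`. Since `□(A → B)` makes `A ∧ ¬B` necessarily false, `(A ∧
¬B) ▷ B`, and J2₊ removes that disjunct. -/
theorem toFml_I2_of_J2p (hX : J2p ⊆ X) : ∀ A ∈ UFml.I2, ILm X A.toFml := by
  rintro _ ⟨A, B, rfl⟩
  refine .of_forall_world fun v w => (w.imp _ _).2 fun h => (w.imp _ _).2 fun hA => ?_
  refine rhd_J2p w hX (B := A.toFml.and B.toFml.neg) (rhd_mono_right w (fun u wu hu => ?_) hA)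
    (rhd_of_box_neg w (box_mono w (fun u wu hu => ?_) h))
  · simp only [wu.or, wu.and, wu.neg]; tauto
  · simp only [UFml.toFml, wu.imp, wu.and, wu.neg] at *; tauto

theorem toFml_I3 (h2 : J2p ⊆ X) (h5 : J5 ⊆ X) : ∀ A ∈ UFml.I3, ILm X A.toFml := by
  rintro _ ⟨A, rfl⟩
  refine .of_forall_world fun v w => (w.imp _ _).2 fun h => ?_
  refine rhd_J2p w h2 (rhd_mono_right w (fun u wu hu => ?_) h) (rhd_J5 w h5)
  exact wu.or.2 (wu.or.1 hu).symm

theorem toFml_I4 (hX : ∀ A ∈ J4, ILm X A) : ∀ A ∈ UFml.I4, ILm X A.toFml := by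
  rintro _ ⟨A, rfl⟩
  refine .of_forall_world fun v w => (w.imp _ _).2 fun h => ?_
  obtain ⟨h₁, h₂⟩ := w.and.1 h
  exact (w.imp _ _).1 ((w.imp _ _).1 (w.thm (hX _ ⟨_, _, rfl⟩)) h₁) h₂

end ILm

theorem ILm_toFml_of_ilm {X : Set Fml} {Y : Set UFml} (hY : ∀ A ∈ Y, ILm X A.toFml) {A : UFml}
    (h : ilm Y A) : ILm X A.toFml := by
  induction h with
  | ax h => exact hY _ h
  | G1 h => exact .G1 fun v hb hv => h (fun B => v B.toFml) hb fun _ _ => hv _ _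
  | G2 A B => exact .G2 _ _
  | G3 A => exact .G3 _
  | uJ6 => exact .J6 ⟨.bot, rfl⟩
  | mp _ _ ih₁ ih₂ => exact .mp ih₁ ih₂
  | nec _ ih => exact .nec ih
  | uR _ ih => exact .R1 _ ih

theorem ILm_toFml_iff_ilm {δ : UFml → UFml} {X : Set Fml} {Y : Set UFml} (hδ : IsWitness δ)
    (hI : ∀ v, UWorld Y v → ∀ A, v (.box (δ A)) → v (.I A))
    (hX : ∀ A ∈ X, ilm Y (A.toUnary δ)) (hY : ∀ A ∈ Y, ILm X A.toFml) (A : UFml) :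
    ILm X A.toFml ↔ ilm Y A :=
  ⟨ilm_of_ILm_toFml hδ hI hX, ILm_toFml_of_ilm hY⟩

/-! ## The two presentations of `CL` and `IL` -/

section Presentations

open Fml

variable {X Z : Set Fml} {v : Fml → Prop} {A B C : Fml}

theorem GLProves.rhd_of_imp (hX : J1 ⊆ X) (h : GLProves X (imp A B)) : GLProves X (rhd A B) :=
  .mp (.nec h) (.ax (hX ⟨A, B, rfl⟩))

theorem GLProves.rhd_trans (hX : J2 ⊆ X) (w : BWorld (GLProves X) v) (h₁ : v (rhd A B))
    (h₂ : v (rhd B C)) : v (rhd A C) :=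
  (w.imp _ _).1 (w.thm (.ax (hX ⟨A, B, C, rfl⟩))) (w.and.2 ⟨h₁, h₂⟩)

theorem GLProves.box_mono (w : BWorld (GLProves X) v)
    (h : ∀ u, BWorld (GLProves X) u → u A → u B) (hA : v (box A)) : v (box B) :=
  (w.imp _ _).1 ((w.imp _ _).1 (w.thm (.G2 A B))
    (w.thm (.nec (.of_forall_world fun u wu => (wu.imp _ _).2 (h u wu))))) hA

/-- What must be recovered is J6 and the rules: J1 and J4 give the two directions of J6, while R1
and R2 are J2 applied to an instance of J1. -/
theorem GLProves.of_ILm (h1 : J1 ⊆ X) (h2 : J2 ⊆ X) (h3 : J3 ⊆ X) (h4 : J4 ⊆ X)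
    (hZ : ∀ A ∈ Z, GLProves X A) (h : ILm Z A) : GLProves X A := by
  induction h with
  | ax h => exact hZ _ h
  | G1 h => exact .G1 h
  | G2 A B => exact .G2 _ _
  | G3 A => exact .G3 _
  | J3 h => exact .ax (h3 h)
  | J6 h =>
    obtain ⟨A, rfl⟩ := h
    refine .of_forall_world fun v w => w.iff.2 ⟨fun hA => ?_, fun hA => ?_⟩
    · refine (w.imp _ _).1 (w.thm (.ax (h1 ⟨_, _, rfl⟩))) (box_mono w (fun u wu hu => ?_) hA)
      simpa only [wu.imp, wu.neg, wu.bot, imp_false, not_not] using hu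
    · have := w.thm (.ax (h4 ⟨A.neg, .bot, rfl⟩))
      rw [w.imp, w.imp, w.dia, w.dia] at this
      by_contra hb
      refine this hA (fun hn => hb (box_mono w (fun u wu hu => ?_) hn))
        (w.thm (.nec (.of_forall_world fun u wu => wu.neg.2 wu.bot)))
      simpa only [wu.neg, not_not] using hu
  | mp _ _ ih₁ ih₂ => exact .mp ih₁ ih₂
  | nec _ ih => exact .nec ih
  | R1 C _ ih =>
    exact .of_forall_world fun v w => (w.imp _ _).2 fun h =>
      rhd_trans h2 w h (w.thm (rhd_of_imp h1 ih))
  | R2 C _ ih =>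
    exact .of_forall_world fun v w => (w.imp _ _).2 fun h =>
      rhd_trans h2 w (w.thm (rhd_of_imp h1 ih)) h

theorem GLProves.J2p_of_J2 (h1 : J1 ⊆ X) (h2 : J2 ⊆ X) (h3 : J3 ⊆ X) :
    ∀ A ∈ J2p, GLProves X A := by
  rintro _ ⟨A, B, C, rfl⟩
  refine .of_forall_world fun v w => (w.imp _ _).2 fun h => ?_
  obtain ⟨h₁, h₂⟩ := w.and.1 h
  have hC : v (rhd C C) :=
    w.thm (rhd_of_imp h1 (.of_forall_world fun u wu => (wu.imp _ _).2 id))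
  exact rhd_trans h2 w h₁ ((w.imp _ _).1 (w.thm (.ax (h3 ⟨B, C, C, rfl⟩))) (w.and.2 ⟨h₂, hC⟩))

theorem GLProves.toILm (hX : ∀ A ∈ X, ILm Z A) (h : GLProves X A) : ILm Z A := by
  induction h with
  | ax h => exact hX _ h
  | G1 h => exact .G1 h
  | G2 A B => exact .G2 _ _
  | G3 A => exact .G3 _
  | mp _ _ ih₁ ih₂ => exact .mp ih₁ ih₂
  | nec _ ih => exact .nec ih

theorem CL_iff_ILm (A : Fml) : CL A ↔ ILm (J1 ∪ J2p) A := by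
  constructor
  · refine GLProves.toILm ?_
    rintro B (((h | h) | h) | h)
    · exact .ax (.inl h)
    · exact ILm.J2_of_J2p Set.subset_union_right B h
    · exact .J3 h
    · exact ILm.J4_of_J2 (ILm.J2_of_J2p Set.subset_union_right) B h
  · have h1 : J1 ⊆ J1 ∪ J2 ∪ J3 ∪ J4 := by grind
    have h2 : J2 ⊆ J1 ∪ J2 ∪ J3 ∪ J4 := by grind
    have h3 : J3 ⊆ J1 ∪ J2 ∪ J3 ∪ J4 := by grind
    have h4 : J4 ⊆ J1 ∪ J2 ∪ J3 ∪ J4 := by grind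
    refine GLProves.of_ILm h1 h2 h3 h4 ?_
    rintro B (h | h)
    · exact .ax (h1 h)
    · exact GLProves.J2p_of_J2 h1 h2 h3 B h

theorem IL_iff_ILm (A : Fml) : IL A ↔ ILm (J1 ∪ J2p ∪ J5) A := by
  have hp : J2p ⊆ J1 ∪ J2p ∪ J5 := by grind
  constructor
  · refine GLProves.toILm ?_
    rintro B ((((h | h) | h) | h) | h)
    · exact .ax (.inl (.inl h))
    · exact ILm.J2_of_J2p hp B h
    · exact .J3 h
    · exact ILm.J4_of_J2 (ILm.J2_of_J2p hp) B h
    · exact .ax (.inr h)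
  · have h1 : J1 ⊆ J1 ∪ J2 ∪ J3 ∪ J4 ∪ J5 := by grind
    have h2 : J2 ⊆ J1 ∪ J2 ∪ J3 ∪ J4 ∪ J5 := by grind
    have h3 : J3 ⊆ J1 ∪ J2 ∪ J3 ∪ J4 ∪ J5 := by grind
    have h4 : J4 ⊆ J1 ∪ J2 ∪ J3 ∪ J4 ∪ J5 := by grind
    refine GLProves.of_ILm h1 h2 h3 h4 ?_
    rintro B ((h | h) | h)
    · exact .ax (h1 h)
    · exact GLProves.J2p_of_J2 h1 h2 h3 B h
    · exact .ax (.inr h)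

end Presentations

/-! ## The rows of the table -/

section Rows

open Fml UFml

variable {Y : Set UFml}

theorem forall_mem_union {α : Type} {S T : Set α} {p : α → Prop} (hS : ∀ a ∈ S, p a)
    (hT : ∀ a ∈ T, p a) : ∀ a ∈ S ∪ T, p a :=
  fun a h => h.elim (hS a) (hT a)

theorem I_of_box_bot : ∀ v, UWorld Y v → ∀ A, v (.box .bot) → v (.I A) :=
  fun _ w _ => w.I_of_box_bot

theorem I_of_box_dia : ∀ v, UWorld Y v → ∀ A, v (.box (.dia A)) → v (.I A) :=
  fun _ w _ h => w.I_of_box_bot (w.box_bot_of_box_dia h)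

theorem I_of_uJ1 (h : uJ1 ⊆ Y) : ∀ v, UWorld Y v → ∀ A, v (.box A) → v (.I A) :=
  fun _ w _ => w.uJ1 h

theorem I_of_uJ15 (h : uJ15 ⊆ Y) :
    ∀ v, UWorld Y v → ∀ A, v (.box (.or A (.dia A))) → v (.I A) :=
  fun _ w _ => w.uJ15 h

theorem I_of_uJ1_I3 (h1 : uJ1 ⊆ Y) (h3 : I3 ⊆ Y) :
    ∀ v, UWorld Y v → ∀ A, v (.box (.or A (.dia A))) → v (.I A) :=
  fun _ w _ h => w.I3 h3 (w.uJ1 h1 h)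

theorem J4_of_I2 (h : I2 ⊆ Y) :
    ∀ v, UWorld Y v → ∀ A, v (.I A) → v (.box (.neg A)) → v (.box .bot) :=
  fun _ w _ => w.box_bot_of_I2 h

theorem J4_of_I4 (h : I4 ⊆ Y) :
    ∀ v, UWorld Y v → ∀ A, v (.I A) → v (.box (.neg A)) → v (.box .bot) :=
  fun _ w _ => w.box_bot_of_I4 h

theorem toUnary_J5_dia : ∀ A ∈ J5, ilm Y (A.toUnary UFml.dia) :=
  toUnary_J5 fun _ _ _ => id

theorem toUnary_J5_or_dia : ∀ A ∈ J5, ilm Y (A.toUnary fun A => .or A (.dia A)) :=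
  toUnary_J5 fun _ w _ h => w.or.2 (.inr h)

theorem toUnary_J1_id : ∀ A ∈ J1, ilm Y (A.toUnary fun A => A) :=
  toUnary_J1 fun _ _ _ => id

theorem toUnary_J1_or_dia : ∀ A ∈ J1, ilm Y (A.toUnary fun A => .or A (.dia A)) :=
  toUnary_J1 fun _ w _ h => w.or.2 (.inl h)

theorem toUnary_J2_dia (h : uJ25 ⊆ Y) : ∀ A ∈ J2, ilm Y (A.toUnary UFml.dia) :=
  toUnary_J2 isWitness_dia fun _ w _ _ h₁ h₂ => .inl (w.uJ25 h h₁ h₂)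

/-- For `δ = ⊥` the premise `□(B → δ C)` is `□¬B`, which together with `I B` leaves only the outcome
`□⊥`. -/
theorem toUnary_J2_bot
    (h : ∀ v, UWorld Y v → ∀ A, v (.I A) → v (.box (.neg A)) → v (.box .bot)) :
    ∀ A ∈ J2, ilm Y (A.toUnary fun _ => .bot) :=
  toUnary_J2 isWitness_bot fun v w _ _ h₁ h₂ => .inr (h v w _ h₂ h₁)

theorem toUnary_J2p_bot (h : I2 ⊆ Y) : ∀ A ∈ J2p, ilm Y (A.toUnary fun _ => .bot) :=
  toUnary_J2p isWitness_bot fun _ w _ _ h₁ => w.I2 h (w.box_mono (fun u wu hu => by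
    simp only [wu.or, wu.imp] at *; exact fun h => h.elim (fun hB => absurd (hu hB) wu.bot) id) h₁)

theorem toUnary_J2p_id (h : I2 ⊆ Y) : ∀ A ∈ J2p, ilm Y (A.toUnary fun A => A) :=
  toUnary_J2p isWitness_id fun _ w _ _ h₁ => w.I2 h (w.box_mono (fun u wu hu => by
    simp only [wu.or, wu.imp] at *; tauto) h₁)

theorem toUnary_J2p_dia (h2 : I2 ⊆ Y) (h3 : I3 ⊆ Y) :
    ∀ A ∈ J2p, ilm Y (A.toUnary UFml.dia) :=
  toUnary_J2p isWitness_dia fun _ w _ _ h₁ => w.I_of_I2_I3 h2 h3 (w.box_mono (fun u wu hu => by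
    simp only [wu.or, wu.imp] at *; exact fun h => .inr (hu h)) h₁)

theorem toUnary_J2p_or_dia (h2 : I2 ⊆ Y) (h3 : I3 ⊆ Y) :
    ∀ A ∈ J2p, ilm Y (A.toUnary fun A => .or A (.dia A)) :=
  toUnary_J2p isWitness_or_dia fun _ w _ _ h₁ => w.I_of_I2_I3 h2 h3 h₁

theorem ILm_J1_J2p (A : UFml) : ILm (J1 ∪ J2p) A.toFml ↔ ilm (uJ1 ∪ I2) A :=
  ILm_toFml_iff_ilm isWitness_id (I_of_uJ1 (by grind))
    (forall_mem_union toUnary_J1_id (toUnary_J2p_id (by grind)))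
    (forall_mem_union (ILm.toFml_uJ1 (by grind)) (ILm.toFml_I2_of_J2p (by grind))) A

theorem ILm_J1_J2p_J5 (A : UFml) :
    ILm (J1 ∪ J2p ∪ J5) A.toFml ↔ ilm (uJ1 ∪ I2 ∪ I3) A :=
  ILm_toFml_iff_ilm isWitness_or_dia (I_of_uJ1_I3 (by grind) (by grind))
    (forall_mem_union (forall_mem_union toUnary_J1_or_dia
      (toUnary_J2p_or_dia (by grind) (by grind))) toUnary_J5_or_dia)
    (forall_mem_union (forall_mem_union (ILm.toFml_uJ1 (by grind))
      (ILm.toFml_I2_of_J2p (by grind))) (ILm.toFml_I3 (by grind) (by grind))) A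

end Rows

end UnaryIL

open UnaryIL UnaryIL.Fml UnaryIL.UFml in
theorem mainTheorem1 :
    ∀ row ∈ UnaryIL.table, ∀ A : UnaryIL.UFml, row.1 A.toFml ↔ row.2 A := by
  have ax {X : Set Fml} {S : Set Fml} (h : S ⊆ X) : ∀ A ∈ S, ILm X A := fun A hA => .ax (h hA)
  simp only [table, List.forall_mem_cons, List.not_mem_nil, false_imp_iff, implies_true, and_true]
  refine ⟨?_, ?_, ?_, ?_, ?_, ?_, ?_, ?_, ?_, ILm_J1_J2p, ?_, ?_, ?_, ILm_J1_J2p_J5,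
    ?_, ?_, ?_, ?_, ?_, ?_, ?_, ?_⟩
  · exact ILm_toFml_iff_ilm isWitness_bot I_of_box_bot (by simp) (by simp)
  · exact ILm_toFml_iff_ilm isWitness_dia I_of_box_dia toUnary_J5_dia (by simp)
  · exact ILm_toFml_iff_ilm isWitness_id (I_of_uJ1 subset_rfl) toUnary_J1_id
      (ILm.toFml_uJ1 subset_rfl)
  · exact ILm_toFml_iff_ilm isWitness_bot I_of_box_bot (toUnary_J4p isWitness_bot subset_rfl)
      (ILm.toFml_I2_of_J4p subset_rfl)
  · exact ILm_toFml_iff_ilm isWitness_dia I_of_box_dia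
      (forall_mem_union (toUnary_J4p isWitness_dia subset_rfl) toUnary_J5_dia)
      (ILm.toFml_I2_of_J4p (by grind))
  · exact ILm_toFml_iff_ilm isWitness_bot I_of_box_bot (toUnary_J2p_bot subset_rfl)
      (ILm.toFml_I2_of_J2p subset_rfl)
  · exact ILm_toFml_iff_ilm isWitness_or_dia (I_of_uJ15 subset_rfl)
      (forall_mem_union toUnary_J1_or_dia toUnary_J5_or_dia)
      (ILm.toFml_uJ15 (by grind) (by grind))
  · exact ILm_toFml_iff_ilm isWitness_id (I_of_uJ1 (by grind))
      (forall_mem_union toUnary_J1_id (toUnary_J4p isWitness_id (by grind)))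
      (forall_mem_union (ILm.toFml_uJ1 (by grind)) (ILm.toFml_I2_of_J4p (by grind)))
  · exact fun A => (CL_iff_ILm _).trans (ILm_J1_J2p A)
  · exact ILm_toFml_iff_ilm isWitness_or_dia (I_of_uJ15 (by grind))
      (forall_mem_union (forall_mem_union toUnary_J1_or_dia
        (toUnary_J4p isWitness_or_dia (by grind))) toUnary_J5_or_dia)
      (forall_mem_union (ILm.toFml_uJ15 (by grind) (by grind))
        (ILm.toFml_I2_of_J4p (by grind)))
  · exact ILm_toFml_iff_ilm isWitness_dia I_of_box_dia
      (forall_mem_union (toUnary_J2p_dia (by grind) (by grind)) toUnary_J5_dia)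
      (forall_mem_union (ILm.toFml_I2_of_J2p (by grind)) (ILm.toFml_I3 (by grind) (by grind)))
  · exact fun A => (IL_iff_ILm _).trans (ILm_J1_J2p_J5 A)
  · exact ILm_toFml_iff_ilm isWitness_bot I_of_box_bot
      (toUnary_J4 isWitness_bot (J4_of_I4 subset_rfl)) (ILm.toFml_I4 (ax subset_rfl))
  · exact ILm_toFml_iff_ilm isWitness_dia I_of_box_dia
      (forall_mem_union (toUnary_J4 isWitness_dia (J4_of_I4 subset_rfl)) toUnary_J5_dia)
      (ILm.toFml_I4 (ax (by grind)))
  · exact ILm_toFml_iff_ilm isWitness_bot I_of_box_bot (toUnary_J2_bot (J4_of_I4 subset_rfl))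
      (ILm.toFml_I4 (ILm.J4_of_J2 (ax subset_rfl)))
  · exact ILm_toFml_iff_ilm isWitness_id (I_of_uJ1 (by grind))
      (forall_mem_union toUnary_J1_id (toUnary_J4 isWitness_id (J4_of_I4 (by grind))))
      (forall_mem_union (ILm.toFml_uJ1 (by grind)) (ILm.toFml_I4 (ax (by grind))))
  · exact ILm_toFml_iff_ilm isWitness_or_dia (I_of_uJ15 (by grind))
      (forall_mem_union (forall_mem_union toUnary_J1_or_dia
        (toUnary_J4 isWitness_or_dia (J4_of_I4 (by grind)))) toUnary_J5_or_dia)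
      (forall_mem_union (ILm.toFml_uJ15 (by grind) (by grind)) (ILm.toFml_I4 (ax (by grind))))
  · exact ILm_toFml_iff_ilm isWitness_dia I_of_box_dia
      (forall_mem_union (toUnary_J2_dia (by grind)) toUnary_J5_dia)
      (forall_mem_union (ILm.toFml_uJ25 (by grind) (by grind))
        (ILm.toFml_I4 (ILm.J4_of_J2 (ax (by grind)))))
  · exact ILm_toFml_iff_ilm isWitness_bot I_of_box_bot
      (forall_mem_union (toUnary_J2_bot (J4_of_I2 subset_rfl))
        (toUnary_J4p isWitness_bot subset_rfl))
      (ILm.toFml_I2_of_J4p (by grind))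
  · exact ILm_toFml_iff_ilm isWitness_dia I_of_box_dia
      (forall_mem_union (forall_mem_union (toUnary_J2_dia (by grind))
        (toUnary_J4p isWitness_dia (by grind))) toUnary_J5_dia)
      (forall_mem_union (ILm.toFml_I2_of_J4p (by grind)) (ILm.toFml_uJ25 (by grind) (by grind)))
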